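/- Let $X_1,X_2,\dots$ be i.i.d. real random variables, and put $S_n=\sum_{i=1}^n X_i$ and $V_n=\sum_{i=1}^n X_i^2$. Define the $[0,\infty]$-valued process $(H_n)_{n\ge 1}$ (the scale invariant t-test extended martingale) by $H_1=\infty$ and $$H_n=\sqrt{\frac{2\pi}{n}}\left(\frac{nV_n}{nV_n-S_n^2}\right)^{n/2}\qquad(n\ge 2),$$ with $H_n=\infty$ whenever $nV_n-S_n^2=0$ (i.e. when $X_1=\dots=X_n$). 1. If the common distribution of the $X_i$ has mean $\mu\in\mathbb R$ and finite variance $\sigma^2>0$ (for example if it is the normal distribution $N(\mu,\sigma^2)$), then $$\lim_{n\to\infty}\frac{\log H_n}{n}=\frac12\log\left(1+\frac{\mu^2}{\sigma^2}\right)\quad\text{almost surely}.$$ 2. If the common distribution is $N(\mu,\sigma^2)$ with $\mu\ne 0$ and $\sigma^2>0$, then almost surely $H_n\to\infty$ exponentially fast: almost surely, for every $c<\frac12\log(1+\mu^2/\sigma^2)$ one has $H_n\ge e^{cn}$ for all sufficiently large $n$. 3. If the common distribution is $N(0,\sigma^2)$ with $\sigma^2>0$, then $H_n\to 0$ almost surely.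 -/

import Mathlib

open MeasureTheory ProbabilityTheory Filter Topology
open scoped ENNReal

/-- `X 0, X 1, X 2, …` (the observations `X₁, X₂, …` of the text) are i.i.d. with law `P`
under the probability measure `Q`. -/
def IsIIDSample {Ω : Type*} [MeasurableSpace Ω] (Q : Measure Ω) (X : ℕ → Ω → ℝ)
    (P : Measure ℝ) : Prop :=
  iIndepFun X Q ∧ ∀ i, HasLaw (X i) P Q

/-- The partial sum `Sₙ` of the first `n` entries of the data sequence `x`. -/
def partialSum (x : ℕ → ℝ) (n : ℕ) : ℝ := ∑ i ∈ Finset.range n, x i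

/-- The partial sum of squares `Vₙ` of the first `n` entries of the data sequence `x`. -/
def partialSumSq (x : ℕ → ℝ) (n : ℕ) : ℝ := ∑ i ∈ Finset.range n, x i ^ 2

open Classical in
/-- The scale invariant t-test extended martingale, as a function of the data sequence:
`H₁ = ∞` and `Hₙ = √(2π/n) (n Vₙ / (n Vₙ - Sₙ²))^(n/2)` for `n ≥ 2`, with value `∞` where the
denominator vanishes, i.e. where the first `n` observations coincide. (`H₀`, which plays no role,
is set to `∞`.) -/
noncomputable def tTestH (x : ℕ → ℝ) (n : ℕ) : ℝ≥0∞ :=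
  if n ≤ 1 ∨ n * partialSumSq x n - partialSum x n ^ 2 = 0 then ∞
  else ENNReal.ofReal (Real.sqrt (2 * Real.pi / n) *
    ((n * partialSumSq x n) / (n * partialSumSq x n - partialSum x n ^ 2)) ^ ((n : ℝ) / 2))

/-! By the strong law `S_n / n → μ` and `V_n / n → μ² + σ²`, so the base of the power in `H_n` tends
to `1 + μ²/σ²`; the prefactor contributes only `O(log n / n)` to `log H_n / n`. This gives the rate,
and exponential growth when `μ ≠ 0`. For `μ = 0` the rate is zero. With `D_n = n V_n - S_n² ~ σ²
n²`, the power is `(1 + S_n²/D_n)^(n/2) ≤ exp(n S_n² / (2 D_n))`, and the prefactor `n^(-1/2)` wins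
once `S_n² ≤ (σ²/4) n log n`. This weak iterated-logarithm bound (`ae_eventually_sum_sq_le`) comes
from a maximal Chernoff inequality on dyadic blocks and Borel–Cantelli. -/

/-! ### Maximal Chernoff inequality for independent sums. -/

section MaximalInequality

variable {Ω : Type*} [MeasurableSpace Ω] {Q : Measure Ω} [IsProbabilityMeasure Q] {X : ℕ → Ω → ℝ}

/-- The exponentials of the partial sums of independent variables with moment generating functions
at least `1` form a submartingale. -/
theorem submartingale_exp_mul_sum (hX : ∀ i, Measurable (X i)) (hind : iIndepFun X Q) {t : ℝ}
    (hint : ∀ i, Integrable (fun ω => Real.exp (t * X i ω)) Q) (hmgf : ∀ i, 1 ≤ mgf (X i) Q t) :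
    Submartingale (fun n ω => Real.exp (t * ∑ i ∈ Finset.range (n + 1), X i ω))
      (Filtration.natural X fun i => (hX i).stronglyMeasurable) Q := by
  set F := Filtration.natural X fun i => (hX i).stronglyMeasurable with hF
  have hXF : ∀ i n, i ≤ n → Measurable[F n] (X i) := fun i n h =>
    ((Filtration.stronglyAdapted_natural fun i => (hX i).stronglyMeasurable) i).measurable.mono
      (F.mono h) le_rfl
  have hfF : ∀ n, Measurable[F n] (fun ω => Real.exp (t * ∑ i ∈ Finset.range (n + 1), X i ω)) := by
    intro n
    refine Real.measurable_exp.comp (Measurable.const_mul ?_ t)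
    exact Finset.measurable_fun_sum _ fun i hi =>
      hXF i n (Nat.lt_succ_iff.mp (Finset.mem_range.mp hi))
  have hfi : ∀ n, Integrable (fun ω => Real.exp (t * ∑ i ∈ Finset.range (n + 1), X i ω)) Q := by
    intro n
    simpa using hind.integrable_exp_mul_sum hX (s := Finset.range (n + 1)) (fun i _ => hint i)
  refine submartingale_of_setIntegral_le_succ (fun n => (hfF n).stronglyMeasurable) hfi ?_
  intro n s hs
  have hs' : MeasurableSet s := F.le n s hs
  set f : Ω → ℝ := fun ω => Real.exp (t * ∑ i ∈ Finset.range (n + 1), X i ω) with hf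
  -- The past up to time `n` is independent of `X (n + 1)`, so the next factor multiplies the
  -- integral over `s` by an mgf that is at least `1`.
  have hindep : IndepFun (s.indicator f) (fun ω => Real.exp (t * X (n + 1) ω)) Q := by
    have h1 : IndepFun (s.indicator f) (X (n + 1)) Q := by
      rw [IndepFun_iff_Indep]
      refine indep_of_indep_of_le_left
        (hind.indep_comap_natural_of_lt (fun i => (hX i).stronglyMeasurable)
          (Nat.lt_succ_self n)).symm ?_
      exact ((hfF n).indicator hs).comap_le
    exact h1.comp (φ := id) (ψ := fun x => Real.exp (t * x)) measurable_id (by fun_prop)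
  have hprod : (fun ω => s.indicator
      (fun ω => Real.exp (t * ∑ i ∈ Finset.range (n + 1 + 1), X i ω)) ω)
      = s.indicator f * fun ω => Real.exp (t * X (n + 1) ω) := by
    ext ω
    by_cases h : ω ∈ s
    · simp [h, hf, Finset.sum_range_succ _ (n + 1), mul_add, Real.exp_add]
    · simp [h]
  rw [← integral_indicator hs', ← integral_indicator hs', hprod,
    hindep.integral_mul_eq_mul_integral
      ((hfi n).indicator hs').aestronglyMeasurable (hint _).aestronglyMeasurable]
  refine le_mul_of_one_le_right ?_ (hmgf (n + 1))
  exact integral_nonneg fun ω => Set.indicator_nonneg (fun _ _ => (Real.exp_pos _).le) ω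

/-- Chernoff's bound for the maximum of the partial sums. -/
theorem measure_exists_le_mul_sum_le (hX : ∀ i, Measurable (X i)) (hind : iIndepFun X Q) {t : ℝ}
    (hint : ∀ i, Integrable (fun ω => Real.exp (t * X i ω)) Q) (hmgf : ∀ i, 1 ≤ mgf (X i) Q t)
    (a : ℝ) (N : ℕ) :
    Q {ω | ∃ k ≤ N, a ≤ t * ∑ i ∈ Finset.range (k + 1), X i ω} ≤
      ENNReal.ofReal (Real.exp (-a) * ∏ i ∈ Finset.range (N + 1), mgf (X i) Q t) := by
  have hsub := submartingale_exp_mul_sum hX hind hint hmgf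
  have hmax := maximal_ineq hsub (fun n ω => (Real.exp_pos _).le)
    (ε := (Real.exp a).toNNReal) N
  have hset : {ω | ∃ k ≤ N, a ≤ t * ∑ i ∈ Finset.range (k + 1), X i ω} =
      {ω | Real.exp a ≤ (Finset.range (N + 1)).sup' Finset.nonempty_range_add_one
        fun k => Real.exp (t * ∑ i ∈ Finset.range (k + 1), X i ω)} := by
    ext ω
    simp [Finset.le_sup'_iff]
  have hle : ∫ ω in {ω | ∃ k ≤ N, a ≤ t * ∑ i ∈ Finset.range (k + 1), X i ω},
      Real.exp (t * ∑ i ∈ Finset.range (N + 1), X i ω) ∂Q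
      ≤ ∏ i ∈ Finset.range (N + 1), mgf (X i) Q t := by
    rw [← hind.mgf_sum hX]
    refine (setIntegral_le_integral (hsub.integrable N)
      (Eventually.of_forall fun ω => (Real.exp_pos _).le)).trans (le_of_eq ?_)
    simp [mgf]
  rw [Real.coe_toNNReal _ (Real.exp_pos a).le, ← hset] at hmax
  have hone : ENNReal.ofReal (Real.exp (-a)) * ENNReal.ofReal (Real.exp a) = 1 := by
    rw [← ENNReal.ofReal_mul (Real.exp_pos _).le, ← Real.exp_add]; simp
  calc Q {ω | ∃ k ≤ N, a ≤ t * ∑ i ∈ Finset.range (k + 1), X i ω}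
      = ENNReal.ofReal (Real.exp (-a)) * (ENNReal.ofReal (Real.exp a) *
          Q {ω | ∃ k ≤ N, a ≤ t * ∑ i ∈ Finset.range (k + 1), X i ω}) := by
        rw [← mul_assoc, hone, one_mul]
    _ ≤ ENNReal.ofReal (Real.exp (-a)) *
          ENNReal.ofReal (∏ i ∈ Finset.range (N + 1), mgf (X i) Q t) := by
        gcongr
        exact hmax.trans (ENNReal.ofReal_le_ofReal hle)
    _ = _ := by rw [← ENNReal.ofReal_mul (Real.exp_pos _).le]

end MaximalInequality

/-! ### Almost sure growth of Gaussian sums. -/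

section GaussianSums

variable {Ω : Type*} [MeasurableSpace Ω] {Q : Measure Ω} [IsProbabilityMeasure Q] {X : ℕ → Ω → ℝ}

/-- The maximal Chernoff bound for centred Gaussian variables. -/
theorem measure_exists_le_mul_sum_gaussian_le (hX : ∀ i, Measurable (X i)) (hind : iIndepFun X Q)
    {v : NNReal} (hlaw : ∀ i, HasLaw (X i) (gaussianReal 0 v) Q) (t a : ℝ) (N : ℕ) :
    Q {ω | ∃ k ≤ N, a ≤ t * ∑ i ∈ Finset.range (k + 1), X i ω} ≤
      ENNReal.ofReal (Real.exp (-a + (N + 1) * (v * t ^ 2 / 2))) := by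
  have hm : ∀ i, mgf (X i) Q t = Real.exp (v * t ^ 2 / 2) := fun i => by
    rw [mgf_gaussianReal (hlaw i).map_eq]; simp
  -- A nonintegrable function has integral `0` by convention, so a nonzero mgf forces integrability.
  have hint : ∀ i, Integrable (fun ω => Real.exp (t * X i ω)) Q := fun i =>
    Integrable.of_integral_ne_zero (by
      have := hm i
      rw [mgf] at this
      rw [this]; exact (Real.exp_pos _).ne')
  refine (measure_exists_le_mul_sum_le hX hind hint
    (fun i => by rw [hm]; exact Real.one_le_exp (by positivity)) a N).trans (le_of_eq ?_)
  simp [hm, Real.exp_add, ← Real.exp_nat_mul]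

/-- A weak form of the law of the iterated logarithm for Gaussian sums. -/
theorem ae_eventually_sum_sq_le_of_measurable (hX : ∀ i, Measurable (X i)) (hind : iIndepFun X Q)
    {v : NNReal} (hv : 0 < v) (hlaw : ∀ i, HasLaw (X i) (gaussianReal 0 v) Q) {δ : ℝ}
    (hδ : 0 < δ) :
    ∀ᵐ ω ∂Q, ∀ᶠ n : ℕ in atTop,
      (∑ i ∈ Finset.range n, X i ω) ^ 2 ≤ δ * (n * Real.log n) := by
  have hv' : (0 : ℝ) < v := hv
  -- The lengths `j + 1 ≤ 2 ^ (k + 1)` cover the dyadic block `2 ^ k ≤ n < 2 ^ (k + 1)`.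
  set A : ℕ → Set Ω := fun k => {ω | ∃ j ≤ 2 ^ (k + 1) - 1,
    δ / 2 * (2 ^ k * k) ≤ (∑ i ∈ Finset.range (j + 1), X i ω) ^ 2} with hA
  have hbound : ∀ k, Q (A k) ≤ 2 * ENNReal.ofReal (Real.exp (-(δ / (8 * v)))) ^ k := by
    intro k
    -- The threshold for `|S|` is `s * 2 ^ k`; `t` minimises the Chernoff exponent over `2 ^ (k +
    -- 1)` terms, and `a = t * s * 2 ^ k`. The powers of two cancel, leaving a bound geometric in
    -- `k`.
    set s : ℝ := Real.sqrt (δ / 2 * k / 2 ^ k) with hs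
    have hs2 : s ^ 2 = δ / 2 * k / 2 ^ k := Real.sq_sqrt (by positivity)
    have hs0 : 0 ≤ s := Real.sqrt_nonneg _
    set t : ℝ := s / (2 * v) with ht
    set a : ℝ := δ / 2 * k / (2 * v) with ha
    have hexp : ∀ u : ℝ, u ^ 2 = t ^ 2 →
        -a + (((2 ^ (k + 1) - 1 : ℕ) : ℝ) + 1) * (v * u ^ 2 / 2) = k * -(δ / (8 * v)) := by
      intro u hu
      have : (((2 ^ (k + 1) - 1 : ℕ) : ℝ) + 1) = 2 * 2 ^ k := by
        rw [Nat.cast_sub Nat.one_le_two_pow]; push_cast; ring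
      rw [this, hu, ht, div_pow, hs2, ha]
      field_simp
      ring
    have hsubset : A k ⊆
        {ω | ∃ j ≤ 2 ^ (k + 1) - 1, a ≤ t * ∑ i ∈ Finset.range (j + 1), X i ω} ∪
        {ω | ∃ j ≤ 2 ^ (k + 1) - 1, a ≤ -t * ∑ i ∈ Finset.range (j + 1), X i ω} := by
      rintro ω ⟨j, hj, hS⟩
      set S := ∑ i ∈ Finset.range (j + 1), X i ω
      have habs : s * 2 ^ k ≤ |S| := by
        refine abs_le_of_sq_le_sq' ?_ (abs_nonneg _) |>.2
        rw [sq_abs, mul_pow, hs2]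
        refine le_trans (le_of_eq ?_) hS
        field_simp
      have hle : a ≤ t * |S| := by
        calc a = t * (s * 2 ^ k) := by
              have : t * (s * 2 ^ k) = s ^ 2 * 2 ^ k / (2 * v) := by rw [ht]; ring
              rw [this, hs2, ha]; field_simp
          _ ≤ t * |S| := by gcongr
      rcases abs_choice S with h | h
      · exact Or.inl ⟨j, hj, by rwa [h] at hle⟩
      · exact Or.inr ⟨j, hj, by rw [h] at hle; linarith⟩
    refine (measure_mono hsubset).trans ((measure_union_le _ _).trans ?_)
    rw [two_mul, ← ENNReal.ofReal_pow (Real.exp_pos _).le, ← Real.exp_nat_mul]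
    refine add_le_add ?_ ?_
    · rw [← hexp t rfl]
      exact measure_exists_le_mul_sum_gaussian_le hX hind hlaw t a _
    · rw [← hexp (-t) (neg_sq t)]
      exact measure_exists_le_mul_sum_gaussian_le hX hind hlaw (-t) a _
  have hsum : ∑' k, Q (A k) ≠ ∞ := by
    refine ne_top_of_le_ne_top ?_ (ENNReal.tsum_le_tsum hbound)
    rw [ENNReal.tsum_mul_left, ENNReal.tsum_geometric]
    refine ENNReal.mul_ne_top (by simp) (ENNReal.inv_ne_top.mpr ?_)
    refine (tsub_pos_of_lt ?_).ne'
    rw [ENNReal.ofReal_lt_one, Real.exp_lt_one_iff]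
    have : 0 < δ / (8 * (v : ℝ)) := by positivity
    linarith
  filter_upwards [ae_eventually_notMem hsum] with ω hω
  have hlog : Tendsto (Nat.log 2) atTop atTop :=
    tendsto_atTop_atTop.mpr fun b => ⟨2 ^ b, fun n hn =>
      Nat.le_log_of_pow_le (by norm_num) hn⟩
  filter_upwards [hlog.eventually hω, eventually_ge_atTop 1] with n hn hn1
  have hlt : n < 2 ^ (Nat.log 2 n + 1) := Nat.lt_pow_succ_log_self (by norm_num) n
  have hle : 2 ^ Nat.log 2 n ≤ n := Nat.pow_log_le_self 2 (by omega)
  have hS : (∑ i ∈ Finset.range n, X i ω) ^ 2 < δ / 2 * (2 ^ Nat.log 2 n * Nat.log 2 n) := by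
    by_contra! h
    exact hn ⟨n - 1, by omega, by rwa [Nat.sub_add_cancel hn1]⟩
  have hleR : (2 : ℝ) ^ Nat.log 2 n ≤ n := by exact_mod_cast hle
  -- Since `log 2 > 1/2`; the factor `2` is absorbed by the `δ / 2` in `A`.
  have hlogR : (Nat.log 2 n : ℝ) ≤ 2 * Real.log n := by
    have h1 : (Nat.log 2 n : ℝ) * Real.log 2 ≤ Real.log n := by
      rw [← Real.log_pow]
      exact Real.log_le_log (by positivity) hleR
    have h2 := Real.log_two_gt_d9
    nlinarith [(Nat.log 2 n).cast_nonneg (α := ℝ)]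
  calc (∑ i ∈ Finset.range n, X i ω) ^ 2 ≤ δ / 2 * (2 ^ Nat.log 2 n * Nat.log 2 n) := hS.le
    _ ≤ δ / 2 * (n * (2 * Real.log n)) := by gcongr
    _ = δ * (n * Real.log n) := by ring

/-- `HasLaw` gives only a.e. measurability, so the bound is transferred from measurable
modifications. -/
theorem ae_eventually_sum_sq_le (hind : iIndepFun X Q) {v : NNReal} (hv : 0 < v)
    (hlaw : ∀ i, HasLaw (X i) (gaussianReal 0 v) Q) {δ : ℝ} (hδ : 0 < δ) :
    ∀ᵐ ω ∂Q, ∀ᶠ n : ℕ in atTop,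
      (∑ i ∈ Finset.range n, X i ω) ^ 2 ≤ δ * (n * Real.log n) := by
  have hae : ∀ i, X i =ᵐ[Q] (hlaw i).aemeasurable.mk (X i) := fun i =>
    (hlaw i).aemeasurable.ae_eq_mk
  have h := ae_eventually_sum_sq_le_of_measurable
    (fun i => (hlaw i).aemeasurable.measurable_mk) (hind.congr hae) hv
    (fun i => (hlaw i).congr (hae i).symm) hδ
  filter_upwards [h, ae_all_iff.mpr hae] with ω hω heq
  simpa only [heq] using hω

end GaussianSums

/-! ### Asymptotics of `tTestH` along a fixed data sequence. -/

section Deterministic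

variable {x : ℕ → ℝ} {μ σ : ℝ}

/-- The quotient is the empirical variance `V_n / n - (S_n / n)²`. -/
theorem tendsto_variance_ratio (hS : Tendsto (fun n : ℕ => partialSum x n / n) atTop (𝓝 μ))
    (hV : Tendsto (fun n : ℕ => partialSumSq x n / n) atTop (𝓝 (μ ^ 2 + σ ^ 2))) :
    Tendsto (fun n : ℕ => (n * partialSumSq x n - partialSum x n ^ 2) / (n : ℝ) ^ 2) atTop
      (𝓝 (σ ^ 2)) := by
  have h := hV.sub (hS.pow 2)
  rw [add_sub_cancel_left] at h
  refine h.congr' ?_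
  filter_upwards [eventually_ge_atTop 1] with n hn
  have : (n : ℝ) ≠ 0 := by positivity
  field_simp

/-- The t-test martingale is the exponential of `n` times a convergent sequence. -/
theorem exists_tendsto_tTestH_eq_exp (hσ : 0 < σ)
    (hS : Tendsto (fun n : ℕ => partialSum x n / n) atTop (𝓝 μ))
    (hV : Tendsto (fun n : ℕ => partialSumSq x n / n) atTop (𝓝 (μ ^ 2 + σ ^ 2))) :
    ∃ a : ℕ → ℝ, Tendsto a atTop (𝓝 (1 / 2 * Real.log (1 + μ ^ 2 / σ ^ 2))) ∧
      ∀ᶠ n in atTop, tTestH x n = ENNReal.ofReal (Real.exp (a n * n)) := by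
  have hD := tendsto_variance_ratio hS hV
  have hσ2 : 0 < σ ^ 2 := by positivity
  have hr : Tendsto (fun n : ℕ => (n * partialSumSq x n) /
      (n * partialSumSq x n - partialSum x n ^ 2)) atTop (𝓝 (1 + μ ^ 2 / σ ^ 2)) := by
    have h := hV.div hD hσ2.ne'
    have hlim : (μ ^ 2 + σ ^ 2) / σ ^ 2 = 1 + μ ^ 2 / σ ^ 2 := by field_simp; ring
    rw [hlim] at h
    refine h.congr' ?_
    filter_upwards [eventually_ge_atTop 1] with n hn
    have : (n : ℝ) ≠ 0 := by positivity
    simp only [Pi.div_apply]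
    rw [div_div_div_eq, ← mul_div_mul_left (n * partialSumSq x n) _ this]
    ring_nf
  have hpos : 0 < 1 + μ ^ 2 / σ ^ 2 := by positivity
  have hlog0 : Tendsto (fun n : ℕ => Real.log n / n) atTop (𝓝 0) :=
    (Real.isLittleO_log_id_atTop.tendsto_div_nhds_zero).comp tendsto_natCast_atTop_atTop
  have hc : Tendsto (fun n : ℕ => Real.log (2 * Real.pi) / n) atTop (𝓝 0) :=
    tendsto_const_div_atTop_nhds_zero_nat _
  refine ⟨fun n => 1 / 2 * (Real.log (2 * Real.pi) / n - Real.log n / n) + 1 / 2 *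
    Real.log ((n * partialSumSq x n) / (n * partialSumSq x n - partialSum x n ^ 2)), ?_, ?_⟩
  · have h := ((hc.sub hlog0).const_mul (1 / 2)).add ((hr.log hpos.ne').const_mul (1 / 2))
    simpa using h
  · filter_upwards [eventually_ge_atTop 2, hD.eventually (lt_mem_nhds hσ2),
      hr.eventually (lt_mem_nhds hpos)] with n hn hDn hrn
    have hn0 : (0 : ℝ) < n := by positivity
    have hne : n * partialSumSq x n - partialSum x n ^ 2 ≠ 0 := by
      intro h
      simp [h] at hDn
    rw [tTestH, if_neg (by push Not; exact ⟨by omega, hne⟩)]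
    congr 1
    have hsq : Real.sqrt (2 * Real.pi / n) =
        Real.exp (1 / 2 * (Real.log (2 * Real.pi) - Real.log n)) := by
      rw [← Real.log_div (by positivity) hn0.ne', Real.sqrt_eq_rpow,
        Real.rpow_def_of_pos (by positivity), mul_comm]
    rw [hsq, Real.rpow_def_of_pos hrn, ← Real.exp_add]
    congr 1
    field_simp

theorem tendsto_log_tTestH_div {L : ℝ} {a : ℕ → ℝ} (ha : Tendsto a atTop (𝓝 L))
    (hH : ∀ᶠ n in atTop, tTestH x n = ENNReal.ofReal (Real.exp (a n * n))) :
    Tendsto (fun n : ℕ => ENNReal.log (tTestH x n) / (n : EReal)) atTop (𝓝 (L : EReal)) := by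
  refine ((continuous_coe_real_ereal.tendsto L).comp ha).congr' ?_
  filter_upwards [hH, eventually_ge_atTop 1] with n hn hn1
  have hn0 : (n : ℝ) ≠ 0 := by positivity
  have hcast : (n : EReal) = ((n : ℝ) : EReal) := by simp
  rw [hn, ENNReal.log_ofReal_of_pos (Real.exp_pos _), Real.log_exp, hcast, ← EReal.coe_div,
    mul_div_cancel_right₀ _ hn0, Function.comp_apply]

theorem eventually_exp_mul_le_tTestH {L c : ℝ} {a : ℕ → ℝ} (ha : Tendsto a atTop (𝓝 L))
    (hH : ∀ᶠ n in atTop, tTestH x n = ENNReal.ofReal (Real.exp (a n * n))) (hc : c < L) :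
    ∀ᶠ n : ℕ in atTop, ENNReal.ofReal (Real.exp (c * n)) ≤ tTestH x n := by
  filter_upwards [hH, ha.eventually (lt_mem_nhds hc)] with n hn hcn
  rw [hn]
  gcongr

theorem tendsto_tTestH_top {c : ℝ} (hc : 0 < c)
    (hH : ∀ᶠ n : ℕ in atTop, ENNReal.ofReal (Real.exp (c * n)) ≤ tTestH x n) :
    Tendsto (fun n : ℕ => tTestH x n) atTop (𝓝 ∞) := by
  refine tendsto_nhds_top_mono ?_ hH
  refine ENNReal.tendsto_ofReal_atTop.comp (Real.tendsto_exp_atTop.comp ?_)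
  exact tendsto_natCast_atTop_atTop.const_mul_atTop hc

/-- If the squared partial sums grow slowly, the t-test martingale vanishes in the limit. -/
theorem tendsto_tTestH_zero (hσ : 0 < σ)
    (hS : Tendsto (fun n : ℕ => partialSum x n / n) atTop (𝓝 0))
    (hV : Tendsto (fun n : ℕ => partialSumSq x n / n) atTop (𝓝 (σ ^ 2)))
    (hlil : ∀ᶠ n : ℕ in atTop, partialSum x n ^ 2 ≤ σ ^ 2 / 4 * (n * Real.log n)) :
    Tendsto (fun n : ℕ => tTestH x n) atTop (𝓝 0) := by
  have hD := tendsto_variance_ratio (σ := σ) hS (by simpa using hV)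
  have hσ2 : 0 < σ ^ 2 := by positivity
  have hbound : ∀ᶠ n : ℕ in atTop, tTestH x n ≤
      ENNReal.ofReal (Real.sqrt (2 * Real.pi) * (n : ℝ) ^ (-(1 / 4) : ℝ)) := by
    filter_upwards [eventually_ge_atTop 2, hD.eventually (lt_mem_nhds (half_lt_self hσ2)), hlil]
      with n hn hDn hSn
    have hn0 : (0 : ℝ) < n := by positivity
    rw [lt_div_iff₀ (by positivity)] at hDn
    have hDpos : 0 < n * partialSumSq x n - partialSum x n ^ 2 :=
      lt_trans (by positivity) hDn
    set D := n * partialSumSq x n - partialSum x n ^ 2 with hDdef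
    rw [tTestH, if_neg (by push Not; exact ⟨by omega, hDpos.ne'⟩)]
    refine ENNReal.ofReal_le_ofReal ?_
    have hratio : (n * partialSumSq x n) / D = partialSum x n ^ 2 / D + 1 := by
      have : n * partialSumSq x n = partialSum x n ^ 2 + D := by rw [hDdef]; ring
      rw [this, add_div, div_self hDpos.ne']
    have hlogn : 0 ≤ Real.log n := Real.log_natCast_nonneg n
    -- The constant `σ² / 4` and `D > σ² n² / 2` make the power at most `n^(1/4)`, leaving
    -- `n^(-1/4)` after the prefactor.
    have hquot : partialSum x n ^ 2 / D * (n / 2) ≤ Real.log n * (1 / 4) := by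
      rw [div_mul_eq_mul_div, div_le_iff₀ hDpos]
      calc partialSum x n ^ 2 * (n / 2) ≤ σ ^ 2 / 4 * (n * Real.log n) * (n / 2) := by gcongr
        _ = Real.log n * (1 / 4) * (σ ^ 2 / 2 * n ^ 2) := by ring
        _ ≤ Real.log n * (1 / 4) * D := by gcongr
    have hpow : ((n * partialSumSq x n) / D) ^ ((n : ℝ) / 2) ≤ (n : ℝ) ^ (1 / 4 : ℝ) := by
      rw [hratio]
      calc (partialSum x n ^ 2 / D + 1) ^ ((n : ℝ) / 2)
          ≤ Real.exp (partialSum x n ^ 2 / D) ^ ((n : ℝ) / 2) := by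
            gcongr
            exact Real.add_one_le_exp _
        _ = Real.exp (partialSum x n ^ 2 / D * (n / 2)) := by rw [← Real.exp_mul]
        _ ≤ Real.exp (Real.log n * (1 / 4)) := Real.exp_le_exp.mpr hquot
        _ = (n : ℝ) ^ (1 / 4 : ℝ) := by rw [Real.rpow_def_of_pos hn0]
    have hsq : Real.sqrt (2 * Real.pi / n) = Real.sqrt (2 * Real.pi) * (n : ℝ) ^ (-(1 / 2) : ℝ) := by
      rw [Real.sqrt_div (by positivity), Real.rpow_neg hn0.le, ← Real.sqrt_eq_rpow, div_eq_mul_inv]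
    calc _ ≤ Real.sqrt (2 * Real.pi / n) * (n : ℝ) ^ (1 / 4 : ℝ) := by gcongr
      _ = _ := by
        rw [hsq, mul_assoc, ← Real.rpow_add hn0]
        norm_num
  have hlim : Tendsto (fun n : ℕ => ENNReal.ofReal
      (Real.sqrt (2 * Real.pi) * (n : ℝ) ^ (-(1 / 4) : ℝ))) atTop (𝓝 0) := by
    have h := (((tendsto_rpow_neg_atTop (y := 1 / 4) (by norm_num)).comp
      tendsto_natCast_atTop_atTop).const_mul (Real.sqrt (2 * Real.pi)))
    rw [mul_zero] at h
    simpa using ENNReal.tendsto_ofReal h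
  exact tendsto_of_tendsto_of_tendsto_of_le_of_le' tendsto_const_nhds hlim
    (Eventually.of_forall fun _ => zero_le) hbound

end Deterministic

/-! ### Empirical moments of an i.i.d. sample. -/

section StrongLaw

variable {Ω : Type*} [MeasurableSpace Ω] {Q : Measure Ω} {X : ℕ → Ω → ℝ} {P : Measure ℝ}

theorem IsIIDSample.ae_tendsto_sum_div (hX : IsIIDSample Q X P) {g : ℝ → ℝ} (hg : Measurable g)
    (hint : Integrable g P) :
    ∀ᵐ ω ∂Q, Tendsto (fun n : ℕ => (∑ i ∈ Finset.range n, g (X i ω)) / n) atTop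
      (𝓝 (∫ x, g x ∂P)) := by
  obtain ⟨hind, hlaw⟩ := hX
  have hid : ∀ i, IdentDistrib (X i) (X 0) Q Q := fun i =>
    ⟨(hlaw i).aemeasurable, (hlaw 0).aemeasurable, by rw [(hlaw i).map_eq, (hlaw 0).map_eq]⟩
  have hint0 : Integrable (fun ω => g (X 0 ω)) Q := by
    rw [← (hlaw 0).map_eq] at hint
    exact hint.comp_aemeasurable (hlaw 0).aemeasurable
  have h := strong_law_ae_real (fun i ω => g (X i ω)) hint0
    (fun i j hij => (hind.indepFun hij).comp hg hg) (fun i => (hid i).comp hg)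
  have hmean : ∫ ω, g (X 0 ω) ∂Q = ∫ x, g x ∂P := by
    simpa [Function.comp_def] using (hlaw 0).integral_comp hg.aestronglyMeasurable
  rwa [hmean] at h

/-- The empirical first and second moments converge almost surely. -/
theorem IsIIDSample.ae_tendsto_moments [IsProbabilityMeasure P] (hX : IsIIDSample Q X P)
    (hP : MemLp id 2 P) {μ σ : ℝ} (hμ : ∫ x, x ∂P = μ) (hσ : variance id P = σ ^ 2) :
    ∀ᵐ ω ∂Q,
      Tendsto (fun n : ℕ => partialSum (fun i => X i ω) n / n) atTop (𝓝 μ) ∧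
      Tendsto (fun n : ℕ => partialSumSq (fun i => X i ω) n / n) atTop (𝓝 (μ ^ 2 + σ ^ 2)) := by
  have hsq : ∫ x, x ^ 2 ∂P = μ ^ 2 + σ ^ 2 := by
    have h := variance_eq_sub hP
    simp only [Pi.pow_apply, id_eq] at h
    rw [hσ, hμ] at h
    linarith
  have h1 := hX.ae_tendsto_sum_div measurable_id (hP.integrable (by norm_num))
  have h2 := hX.ae_tendsto_sum_div (g := fun x => x ^ 2) (by fun_prop) hP.integrable_sq
  rw [hsq] at h2
  simp only [id_eq, hμ] at h1
  filter_upwards [h1, h2] with ω h1 h2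
  exact ⟨h1, h2⟩

end StrongLaw

theorem mainTheorem11 {Ω : Type*} [MeasurableSpace Ω] (Q : Measure Ω) [IsProbabilityMeasure Q]
    (X : ℕ → Ω → ℝ) :
    -- any law with mean `μ` and variance `σ² > 0`
    (∀ (P : Measure ℝ) (μ σ : ℝ), IsProbabilityMeasure P → MemLp id 2 P → ∫ x, x ∂P = μ →
      variance id P = σ ^ 2 → 0 < σ → IsIIDSample Q X P →
      ∀ᵐ ω ∂Q, Tendsto (fun n : ℕ => ENNReal.log (tTestH (fun i => X i ω) n) / (n : EReal)) atTop
        (𝓝 (((1 / 2 * Real.log (1 + μ ^ 2 / σ ^ 2) : ℝ)) : EReal))) ∧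
    -- any nondegenerate normal law with nonzero mean: divergence to `∞`, exponentially fast
    (∀ (μ σ : ℝ), μ ≠ 0 → 0 < σ → IsIIDSample Q X (gaussianReal μ (Real.toNNReal (σ ^ 2))) →
      ∀ᵐ ω ∂Q, Tendsto (fun n : ℕ => tTestH (fun i => X i ω) n) atTop (𝓝 ∞) ∧
        ∀ c : ℝ, c < 1 / 2 * Real.log (1 + μ ^ 2 / σ ^ 2) →
          ∀ᶠ n : ℕ in atTop, ENNReal.ofReal (Real.exp (c * n)) ≤ tTestH (fun i => X i ω) n) ∧
    -- any nondegenerate normal law with mean zero: convergence to `0`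
    (∀ σ : ℝ, 0 < σ → IsIIDSample Q X (gaussianReal 0 (Real.toNNReal (σ ^ 2))) →
      ∀ᵐ ω ∂Q, Tendsto (fun n : ℕ => tTestH (fun i => X i ω) n) atTop (𝓝 0)) := by
  have hgauss : ∀ μ σ : ℝ, IsIIDSample Q X (gaussianReal μ (Real.toNNReal (σ ^ 2))) →
      ∀ᵐ ω ∂Q,
        Tendsto (fun n : ℕ => partialSum (fun i => X i ω) n / n) atTop (𝓝 μ) ∧
        Tendsto (fun n : ℕ => partialSumSq (fun i => X i ω) n / n) atTop (𝓝 (μ ^ 2 + σ ^ 2)) :=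
    fun μ σ hX => hX.ae_tendsto_moments (memLp_id_gaussianReal 2) integral_id_gaussianReal
      (by rw [variance_id_gaussianReal, Real.coe_toNNReal _ (sq_nonneg σ)])
  refine ⟨?_, ?_, ?_⟩
  · intro P μ σ hP hLp hμ hvar hσ hX
    filter_upwards [hX.ae_tendsto_moments hLp hμ hvar] with ω ⟨hS, hV⟩
    obtain ⟨a, ha, hH⟩ := exists_tendsto_tTestH_eq_exp hσ hS hV
    exact tendsto_log_tTestH_div ha hH
  · intro μ σ hμ hσ hX
    filter_upwards [hgauss μ σ hX] with ω ⟨hS, hV⟩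
    obtain ⟨a, ha, hH⟩ := exists_tendsto_tTestH_eq_exp hσ hS hV
    have hpos : 0 < 1 / 2 * Real.log (1 + μ ^ 2 / σ ^ 2) := by
      have : 0 < μ ^ 2 / σ ^ 2 := by positivity
      have := Real.log_pos (show 1 < 1 + μ ^ 2 / σ ^ 2 by linarith)
      positivity
    -- Any positive rate below the limit yields divergence; half of it is used.
    exact ⟨tendsto_tTestH_top (half_pos hpos)
      (eventually_exp_mul_le_tTestH ha hH (half_lt_self hpos)),
      fun c hc => eventually_exp_mul_le_tTestH ha hH hc⟩
  · intro σ hσ hX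
    have hσ2 : 0 < σ ^ 2 := by positivity
    filter_upwards [hgauss 0 σ hX, ae_eventually_sum_sq_le hX.1 (Real.toNNReal_pos.mpr hσ2) hX.2
      (show 0 < σ ^ 2 / 4 by positivity)] with ω ⟨hS, hV⟩ hlil
    exact tendsto_tTestH_zero hσ hS (by simpa using hV) hlil
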